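/- **Setting.** Let $M$ be a compact smooth parallelizable manifold without boundary, of dimension $n\ge 2$, with a smooth Riemannian metric $g^0$, its Riemannian volume ${\rm dv}$ and a global $g^0$-orthonormal frame. Let $\{\psi_j\}_{j\ge 0}$ be a complete orthonormal basis of $L^2(M,{\rm dv})$ with $\Delta_{g^0}\psi_j+\lambda_j\psi_j=0$ and $\lambda_j$ non-decreasing. Let $\beta_j=F(\lambda_j)$ ($j\ge1$), where $F$ is monotonically decreasing on $[\lambda_1,\infty)$ and $F(t)\to0$ as $t\to\infty$; suppose that $\beta_1>0$ and $\sum_{j\ge1}\beta_j^2<\infty$. Let $\xi_1,\xi_2,\dots$ be i.i.d. standard Gaussian vectors in $\mathbb R^n$, let $\pi_n$ be the orthogonal projection of $\mathbb R^n$ on the hyperplane $\sum_i x_i=0$, and let $$H_x=\sum_{j=1}^\infty \pi_n(\xi_j)\,\beta_j\,\psi_j(x),$$ the series converging almost surely in $L^2(M;\mathbb R^n)$. Let $a_x=\exp(H_x)$ (a positive diagonal matrix), let $k_x\in \mathrm{SO}(n)$ be arbitrary (possibly random), and let $g^1$ be the random metric whose matrix at $x$ in the frame is $k_xa_x^2k_x^{-1}$.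 For two inner products $g,g'$ on $T_xM$ let $d_x(g,g')=\big(\sum_i b_i^2\big)^{1/2}$, where in some $g$-orthonormal basis $g'$ is diagonal with entries $e^{2b_i}$, and let $$\Omega_2=\Omega_2(g^0,g^1)=\Big(\int_M d_x(g^0_x,g^1_x)^2\,{\rm dv}(x)\Big)^{1/2}.$$ Define $A,B\ge0$ by $A^2=(n-1)\sum_{j\ge1}\beta_j^2$ and $B^4=(n-1)\sum_{j\ge1}\beta_j^4$. **Theorem.** There are an absolute constant $c>0$ and a constant $C=C(A,B,\beta_1^2)>0$, depending only on $A$, $B$ and $\beta_1^2$, such that in the above setting, for every $R\ge A$, $$\frac{c\,\beta_1}{R}\exp\Big(\frac{-R^2}{2\beta_1^2}\Big)\;\le\;\mathrm{Prob}\{\Omega_2\ge R\}\;\le\;\exp\Big(\frac{-R^2}{2\beta_1^2}+CR\Big).$$ -/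

import Mathlib

open MeasureTheory ProbabilityTheory Filter Topology
open scoped ENNReal Manifold ContDiff Matrix

noncomputable section

namespace RandomMetric

/-! ### Riemannian geometry of the reference metric -/

section Geometry

variable {n : ℕ} {M : Type*} [TopologicalSpace M] [ChartedSpace (EuclideanSpace ℝ (Fin n)) M]
  [IsManifold (𝓡 n) ∞ M]

/-- Smooth Riemannian metrics on the `n`-dimensional manifold `M`. -/
abbrev Metric (n : ℕ) (M : Type*) [TopologicalSpace M]
    [ChartedSpace (EuclideanSpace ℝ (Fin n)) M] [IsManifold (𝓡 n) ∞ M] : Type _ :=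
  Bundle.ContMDiffRiemannianMetric (𝓡 n) ∞ (EuclideanSpace ℝ (Fin n))
    (fun x : M => TangentSpace (𝓡 n) x)

/-- A field of bilinear forms on the tangent spaces of `M`. -/
abbrev FormField (n : ℕ) (M : Type*) [TopologicalSpace M]
    [ChartedSpace (EuclideanSpace ℝ (Fin n)) M] : Type _ :=
  (x : M) → TangentSpace (𝓡 n) x →L[ℝ] TangentSpace (𝓡 n) x →L[ℝ] ℝ

/-- The `i`-th standard basis vector of `ℝⁿ`. -/
def stdVec (i : Fin n) : EuclideanSpace ℝ (Fin n) := EuclideanSpace.single i 1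

/-- The `i`-th coordinate vector field of the chart at `x`, at the point with coordinates `y`. -/
def coordVec (x : M) (y : EuclideanSpace ℝ (Fin n)) (i : Fin n) :
    TangentSpace (𝓡 n) ((extChartAt (𝓡 n) x).symm y) :=
  mfderiv 𝓘(ℝ, EuclideanSpace ℝ (Fin n)) (𝓡 n) (extChartAt (𝓡 n) x).symm y (stdVec i)

/-- The matrix `(g_ij)` of the metric in the chart at `x`, at the point with coordinates `y`. -/
def chartGram (g : Metric n M) (x : M) (y : EuclideanSpace ℝ (Fin n)) :
    Matrix (Fin n) (Fin n) ℝ :=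
  Matrix.of fun i j =>
    g.inner ((extChartAt (𝓡 n) x).symm y) (coordVec x y i) (coordVec x y j)

/-- `√det (g_ij)` in the chart at `x`. -/
def chartDensity (g : Metric n M) (x : M) (y : EuclideanSpace ℝ (Fin n)) : ℝ :=
  Real.sqrt (chartGram g x y).det

/-- The partial derivative `∂_i` on `ℝⁿ`. -/
def partialDeriv (i : Fin n) (F : EuclideanSpace ℝ (Fin n) → ℝ)
    (y : EuclideanSpace ℝ (Fin n)) : ℝ :=
  fderiv ℝ F y (stdVec i)

/-- The Laplace-Beltrami operator
`Δ_g u = (det g)^(-1/2) ∑_i ∂_i ((det g)^(1/2) ∑_j g^ij ∂_j u)`,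
computed at `x` in the preferred chart at `x`. -/
def laplaceBeltrami (g : Metric n M) (u : M → ℝ) (x : M) : ℝ :=
  (chartDensity g x (extChartAt (𝓡 n) x x))⁻¹ *
    ∑ i, partialDeriv i
      (fun y => chartDensity g x y *
        ∑ j, (chartGram g x y)⁻¹ i j * partialDeriv j (u ∘ (extChartAt (𝓡 n) x).symm) y)
      (extChartAt (𝓡 n) x x)

/-- `dv` is the Riemannian volume of `g`: in every preferred chart it has density `√det (g_ij)`
with respect to Lebesgue measure. -/
def IsRiemannianVolume [MeasurableSpace M] (g : Metric n M) (dv : Measure M) : Prop :=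
  ∀ (x : M) (s : Set M), MeasurableSet s → s ⊆ (chartAt (EuclideanSpace ℝ (Fin n)) x).source →
    dv s = ∫⁻ y in extChartAt (𝓡 n) x '' s, ENNReal.ofReal (chartDensity g x y)

/-- `f` is a global continuous frame of the tangent bundle, orthonormal for `g`. (By dimension,
`n` orthonormal vectors form a basis of each tangent space.) -/
structure IsOrthonormalFrame (g : Metric n M)
    (f : Fin n → (x : M) → TangentSpace (𝓡 n) x) : Prop where
  continuous : ∀ i, Continuous fun x => (⟨x, f i x⟩ : TangentBundle (𝓡 n) M)
  orthonormal : ∀ x i j, g.inner x (f i x) (f j x) = if i = j then 1 else 0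

/-- `ψ 0, ψ 1, …` is a complete orthonormal basis of (real) `L²(M, dv)` of smooth Laplace
eigenfunctions, `Δ ψ_j + lam_j ψ_j = 0`, with the eigenvalues in non-decreasing order. -/
structure IsSpectralBasis [MeasurableSpace M] (g : Metric n M) (dv : Measure M)
    (lam : ℕ → ℝ) (ψ : ℕ → M → ℝ) : Prop where
  smooth : ∀ j, ContMDiff (𝓡 n) 𝓘(ℝ, ℝ) ∞ (ψ j)
  eigen : ∀ j x, laplaceBeltrami g (ψ j) x + lam j * ψ j x = 0
  monotone : Monotone lam
  orthonormal : ∀ i j, ∫ x, ψ i x * ψ j x ∂dv = if i = j then 1 else 0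
  complete : ∀ h : M → ℝ, MemLp h 2 dv → (∀ j, ∫ x, h x * ψ j x ∂dv = 0) → h =ᵐ[dv] 0

end Geometry

/-! ### The `L²` distance on metrics with a fixed volume form -/

section Distance

/-- `g'` is in relative position `exp b` to `g`: in some `g`-orthonormal basis the form `g'` is
diagonal with entries `exp (b i) ^ 2`; that is, `g' = (k a) · g` with `k` orthogonal for `g` and `a`
the positive diagonal matrix with entries `exp (b i)`. The vector `b` is unique up to order. -/
def IsRelativePosition {n : ℕ} {V : Type*} [AddCommGroup V] [Module ℝ V] [TopologicalSpace V]
    [IsTopologicalAddGroup V] [ContinuousSMul ℝ V]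
    (g g' : V →L[ℝ] V →L[ℝ] ℝ) (b : EuclideanSpace ℝ (Fin n)) : Prop :=
  ∃ e : Module.Basis (Fin n) ℝ V,
    (∀ i j, g (e i) (e j) = if i = j then 1 else 0) ∧
    (∀ i j, g' (e i) (e j) = if i = j then Real.exp (b i) ^ 2 else 0)

/-- The symmetric space distance `‖log a‖` of two positive forms in relative position `a`. The
set below has exactly one element when `g`, `g'` are inner products and `V` has dimension `n`. -/
def fiberDist (n : ℕ) {V : Type*} [AddCommGroup V] [Module ℝ V] [TopologicalSpace V]
    [IsTopologicalAddGroup V] [ContinuousSMul ℝ V] (g g' : V →L[ℝ] V →L[ℝ] ℝ) : ℝ :=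
  sInf {r : ℝ | ∃ b : EuclideanSpace ℝ (Fin n), IsRelativePosition g g' b ∧ r = ‖b‖}

/-- `Ω₂(g, g')`, with `Ω₂(g, g')² = ∫_M d_x(g_x, g'_x)² dv(x)`. -/
def Omega2 {n : ℕ} {M : Type*} [TopologicalSpace M] [ChartedSpace (EuclideanSpace ℝ (Fin n)) M]
    [MeasurableSpace M] (dv : Measure M) (g g' : FormField n M) : ℝ :=
  Real.sqrt (∫ x, fiberDist n (g x) (g' x) ^ 2 ∂dv)

end Distance

/-! ### The Gaussian random metric -/

section RandomField

/-- The hyperplane `x_1 + ⋯ + x_n = 0`, i.e. the diagonal matrices of trace zero. -/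
def traceZero (n : ℕ) : Submodule ℝ (EuclideanSpace ℝ (Fin n)) where
  carrier := {x | ∑ i, x i = 0}
  add_mem' := by
    intro x y hx hy
    simp only [Set.mem_ofPred_eq, PiLp.add_apply, Finset.sum_add_distrib] at *
    rw [hx, hy, add_zero]
  zero_mem' := by simp
  smul_mem' := by
    intro c x hx
    simp only [Set.mem_ofPred_eq, PiLp.smul_apply, smul_eq_mul, ← Finset.mul_sum] at *
    rw [hx, mul_zero]

/-- `π_n`, the orthogonal projection of `ℝⁿ` on the hyperplane `x_1 + ⋯ + x_n = 0`. -/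
def proj (n : ℕ) : EuclideanSpace ℝ (Fin n) →L[ℝ] EuclideanSpace ℝ (Fin n) :=
  (traceZero n).starProjection

/-- `ξ 0, ξ 1, …` are i.i.d. standard Gaussian vectors in `ℝⁿ`. -/
structure IsIIDStdGaussian {n : ℕ} {Ω : Type*} [MeasurableSpace Ω] (P : Measure Ω)
    (ξ : ℕ → Ω → EuclideanSpace ℝ (Fin n)) : Prop where
  law : ∀ j, HasLaw (ξ j) (stdGaussian (EuclideanSpace ℝ (Fin n))) P
  indep : iIndepFun ξ P

/-- The partial sum over `j = 1, …, N` of the random series `∑_j π_n(ξ_j) β_j ψ_j(x)`; the Gaussian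
vector that goes with the index `j + 1` is `ξ j`. -/
def radialPartialSum {n : ℕ} {M Ω : Type*} (β : ℕ → ℝ) (ψ : ℕ → M → ℝ)
    (ξ : ℕ → Ω → EuclideanSpace ℝ (Fin n)) (N : ℕ) (w : Ω) (x : M) :
    EuclideanSpace ℝ (Fin n) :=
  ∑ j ∈ Finset.range N, (β (j + 1) * ψ (j + 1) x) • proj n (ξ j w)

/-- `H` is the sum of the random series `∑_{j ≥ 1} π_n(ξ_j) β_j ψ_j`: almost surely, the series
converges to `H` in `L²(M, dv; ℝⁿ)`. When the `β_j` are square summable the series does converge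
so, and it determines `H` up to null sets. -/
def IsRadialField {n : ℕ} {M Ω : Type*} [MeasurableSpace M] [MeasurableSpace Ω] (P : Measure Ω)
    (dv : Measure M) (β : ℕ → ℝ) (ψ : ℕ → M → ℝ) (ξ : ℕ → Ω → EuclideanSpace ℝ (Fin n))
    (H : Ω → M → EuclideanSpace ℝ (Fin n)) : Prop :=
  ∀ᵐ w ∂P, MemLp (H w) 2 dv ∧
    Tendsto (fun N => eLpNorm (fun x => H w x - radialPartialSum β ψ ξ N w x) 2 dv) atTop (𝓝 0)

/-- The field of forms that in the `g`-orthonormal frame `f` has the matrix `k_x a_x² k_x⁻¹`, where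
`a_x = exp (H_x)` is diagonal and `k_x` is a rotation. -/
def deformedMetric {n : ℕ} {M : Type*} [TopologicalSpace M]
    [ChartedSpace (EuclideanSpace ℝ (Fin n)) M] [IsManifold (𝓡 n) ∞ M] (g : Metric n M)
    (f : Fin n → (x : M) → TangentSpace (𝓡 n) x)
    (k : M → Matrix.specialOrthogonalGroup (Fin n) ℝ)
    (H : M → EuclideanSpace ℝ (Fin n)) : FormField n M :=
  fun x => ∑ i, ∑ j,
    ((k x : Matrix (Fin n) (Fin n) ℝ) * Matrix.diagonal (fun l => Real.exp (H x l)) ^ 2 *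
      (k x : Matrix (Fin n) (Fin n) ℝ)⁻¹) i j •
      (g.inner x (f i x)).smulRight (g.inner x (f j x))

/-- `A`, with `A² = (n - 1) ∑_{j ≥ 1} β_j²`. -/
def constA (n : ℕ) (β : ℕ → ℝ) : ℝ :=
  Real.sqrt (((n : ℝ) - 1) * ∑' j : ℕ, β (j + 1) ^ 2)

/-- `B`, with `B⁴ = (n - 1) ∑_{j ≥ 1} β_j⁴`. -/
def constB (n : ℕ) (β : ℕ → ℝ) : ℝ :=
  Real.sqrt (Real.sqrt (((n : ℝ) - 1) * ∑' j : ℕ, β (j + 1) ^ 4))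

end RandomField

end RandomMetric

end

/-!
The distance `Ω₂` sees only the radial part of the random metric: at each point the relative
position of `g⁰` and `g¹` is `exp H_x` (the columns of the rotation `k_x` diagonalize `g¹`), so
`Ω₂² = ∫ ‖H_x‖² dv` (`Omega2_deformedMetric`). Since the `ψ_j` are orthonormal, Parseval's
identity turns this into a weighted series of independent chi-square variables, `Ω₂² = ∑_j β_j²
‖π_n ξ_j‖²` almost surely (`IsRadialField.tendsto_sum`).

The upper bound (`IsIIDStdGaussian.measureReal_le_exp`) is Chernoff's inequality. The elementary
estimate `E exp (s ‖ξ‖²) = (1 - 2 s) ^ (-n / 2) ≤ exp (n s / (1 - 2 s))` controls the exponential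
moment of the series by `A` as soon as all `1 - 2 θ β_j²` are bounded below, and `β_1` is the
largest coefficient. With the Chernoff parameter `θ` given by `2 θ β_1² = 1 - A / R`, both the
loss in the leading term and the logarithm of the moment are linear in `R`, which gives `C = 1 + 3
A / (2 β_1²)`; the constant `B` does not enter.

The lower bound (`IsIIDStdGaussian.exp_le_measureReal`) keeps the term `j = 1` only, where `‖π_n
ξ_1‖ ≥ ⟪v, ξ_1⟫` for a unit vector `v` of the hyperplane, and estimates the tail of the standard
normal variable `⟪v, ξ_1⟫` at `R / β_1 ≥ 1`.
-/

namespace RandomMetric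

/-! ### Relative position of the deformed metric -/

section LinearAlgebra

variable {n : ℕ} {V : Type*} [AddCommGroup V] [Module ℝ V] [TopologicalSpace V]
  [IsTopologicalAddGroup V] [ContinuousSMul ℝ V] {g g' : V →L[ℝ] V →L[ℝ] ℝ}

/-- The relative position of two forms is unique up to order; only the invariance of its norm is
needed. If `e`, `e'` are two `g`-orthonormal bases that diagonalize `g'`, then `p i j = g (e i)
(e' j)` is an orthogonal matrix with `p i j = 0` unless `b i = b' j`, so `∑ i, b i ^ 2 = ∑ i, ∑ j,
p i j ^ 2 * b i ^ 2 = ∑ j, b' j ^ 2`. -/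
theorem IsRelativePosition.norm_eq {b b' : EuclideanSpace ℝ (Fin n)}
    (h : IsRelativePosition g g' b) (h' : IsRelativePosition g g' b') : ‖b‖ = ‖b'‖ := by
  obtain ⟨e, he, heb⟩ := h
  obtain ⟨e', he', heb'⟩ := h'
  have key (G : V →L[ℝ] V →L[ℝ] ℝ) (d : Fin n → ℝ)
      (hG : ∀ i j, G (e i) (e j) = if i = j then d i else 0) (i j : Fin n) :
      G (e i) (e' j) = e.repr (e' j) i * d i := by
    conv_lhs => rw [← e.sum_repr (e' j), map_sum]
    simp_rw [map_smul, hG]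
    simp
  have key' (G : V →L[ℝ] V →L[ℝ] ℝ) (d : Fin n → ℝ)
      (hG : ∀ i j, G (e' i) (e' j) = if i = j then d i else 0) (i j : Fin n) :
      G (e i) (e' j) = e'.repr (e i) j * d j := by
    conv_lhs => rw [← e'.sum_repr (e i), map_sum, _root_.sum_apply]
    simp_rw [map_smul, _root_.smul_apply, hG]
    simp
  have hc (i j) : g (e i) (e' j) = e.repr (e' j) i := by
    simpa using key g (fun _ => 1) he i j
  have hd (i j) : g (e i) (e' j) = e'.repr (e i) j := by
    simpa using key' g (fun _ => 1) he' i j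
  have hrow (i) : ∑ j, g (e i) (e' j) ^ 2 = 1 := by
    have h1 : g (e i) (∑ j, e'.repr (e i) j • e' j) = 1 := by
      rw [e'.sum_repr, he]; simp
    rw [← h1]
    simp [← hd, pow_two]
  have hcol (j) : ∑ i, g (e i) (e' j) ^ 2 = 1 := by
    have h1 : g (∑ i, e.repr (e' j) i • e i) (e' j) = 1 := by
      rw [e.sum_repr, he']; simp
    rw [← h1]
    simp [← hc, pow_two]
  -- Both expansions of `g' (e i) (e' j)` agree, so
  -- `p i j * exp (b i) ^ 2 = p i j * exp (b' j) ^ 2`.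
  have hb (i j) : g (e i) (e' j) ^ 2 * b i ^ 2 = g (e i) (e' j) ^ 2 * b' j ^ 2 := by
    have h1 := key g' (fun i => Real.exp (b i) ^ 2) heb i j
    rw [key' g' (fun i => Real.exp (b' i) ^ 2) heb' i j, ← hc, ← hd] at h1
    rcases mul_eq_mul_left_iff.mp h1 with h2 | h2
    · have h3 := (pow_left_inj₀ (Real.exp_pos _).le (Real.exp_pos _).le two_ne_zero).mp h2
      rw [Real.exp_injective h3]
    · simp [h2]
  have hsq : ∑ i, b i ^ 2 = ∑ j, b' j ^ 2 := by
    calc ∑ i, b i ^ 2 = ∑ i, ∑ j, g (e i) (e' j) ^ 2 * b i ^ 2 := by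
          simp_rw [← Finset.sum_mul, hrow, one_mul]
      _ = ∑ j, ∑ i, g (e i) (e' j) ^ 2 * b' j ^ 2 := by
          simp_rw [hb]; exact Finset.sum_comm
      _ = ∑ j, b' j ^ 2 := by simp_rw [← Finset.sum_mul, hcol, one_mul]
  rw [EuclideanSpace.norm_eq, EuclideanSpace.norm_eq]
  simp [hsq]

theorem IsRelativePosition.fiberDist_eq {b : EuclideanSpace ℝ (Fin n)}
    (h : IsRelativePosition g g' b) : fiberDist n g g' = ‖b‖ := by
  have : {r : ℝ | ∃ b : EuclideanSpace ℝ (Fin n), IsRelativePosition g g' b ∧ r = ‖b‖}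
      = {‖b‖} := by
    ext r
    constructor
    · rintro ⟨b', hb', rfl⟩
      exact hb'.norm_eq h
    · rintro rfl
      exact ⟨b, h, rfl⟩
  rw [fiberDist, this, csInf_singleton]

/-- The form with matrix `k (exp b)² k⁻¹` in an orthonormal frame `f` is diagonalized by the columns
of the orthogonal matrix `k`. -/
theorem isRelativePosition_of_frame (hV : Module.finrank ℝ V = n) (hn : 0 < n)
    {f : Fin n → V} (hf : ∀ i j, g (f i) (f j) = if i = j then 1 else 0)
    {k : Matrix (Fin n) (Fin n) ℝ} (hk : kᵀ * k = 1) (b : EuclideanSpace ℝ (Fin n)) :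
    IsRelativePosition g (∑ i, ∑ j,
      (k * Matrix.diagonal (fun l => Real.exp (b l)) ^ 2 * k⁻¹) i j •
        (g (f i)).smulRight (g (f j))) b := by
  set e : Fin n → V := fun l => ∑ i, k i l • f i with he
  have hfe (i l) : g (f i) (e l) = k i l := by simp [he, hf]
  have hee (l m) : g (e l) (e m) = if l = m then 1 else 0 := by
    have h1 : g (e l) (e m) = (kᵀ * k) l m := by
      have h2 : g (e l) = ∑ i, k i l • g (f i) := by simp only [he, map_sum, map_smul]
      rw [h2]
      simp [hfe, Matrix.mul_apply]
    rw [h1, hk, Matrix.one_apply]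
  have hli : LinearIndependent ℝ e := by
    rw [Fintype.linearIndependent_iff]
    intro c hc l
    have h1 : g (e l) (∑ m, c m • e m) = c l := by simp [hee]
    rw [← h1, hc, map_zero]
  have : Nonempty (Fin n) := ⟨⟨0, hn⟩⟩
  refine ⟨basisOfLinearIndependentOfCardEqFinrank hli (by simp [hV]), ?_, ?_⟩
  · simpa using hee
  · intro l m
    have hinv : k⁻¹ = kᵀ := Matrix.inv_eq_left_inv hk
    have h1 : kᵀ * (k * Matrix.diagonal (fun l => Real.exp (b l)) ^ 2 * k⁻¹) * k
        = Matrix.diagonal (fun l => Real.exp (b l) ^ 2) := by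
      calc kᵀ * (k * Matrix.diagonal (fun l => Real.exp (b l)) ^ 2 * k⁻¹) * k
          = (kᵀ * k) * Matrix.diagonal (fun l => Real.exp (b l)) ^ 2 * (kᵀ * k) := by
            rw [hinv]; simp only [Matrix.mul_assoc]
        _ = _ := by
            rw [hk, one_mul, mul_one, Matrix.diagonal_pow]; rfl
    have h2 := congrFun (congrFun h1 l) m
    rw [Matrix.diagonal_apply] at h2
    rw [← h2]
    generalize k * Matrix.diagonal (fun l => Real.exp (b l)) ^ 2 * k⁻¹ = K
    simp only [coe_basisOfLinearIndependentOfCardEqFinrank, _root_.sum_apply,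
      _root_.smul_apply, ContinuousLinearMap.smulRight_apply, hfe, smul_eq_mul,
      Matrix.mul_apply, Matrix.transpose_apply, Finset.sum_mul]
    rw [Finset.sum_comm]
    exact Finset.sum_congr rfl fun i _ => Finset.sum_congr rfl fun j _ => by ring

end LinearAlgebra

section Deformed

variable {n : ℕ} {M : Type*} [TopologicalSpace M] [ChartedSpace (EuclideanSpace ℝ (Fin n)) M]
  [IsManifold (𝓡 n) ∞ M]

theorem fiberDist_deformedMetric (hn : 0 < n) {g : Metric n M}
    {f : Fin n → (x : M) → TangentSpace (𝓡 n) x} (hf : IsOrthonormalFrame g f)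
    (k : M → Matrix.specialOrthogonalGroup (Fin n) ℝ) (H : M → EuclideanSpace ℝ (Fin n)) (x : M) :
    fiberDist n (g.inner x) (deformedMetric g f k H x) = ‖H x‖ := by
  have hV : Module.finrank ℝ (TangentSpace (𝓡 n) x) = n := by
    change Module.finrank ℝ (EuclideanSpace ℝ (Fin n)) = n
    simp
  have hk : (k x : Matrix (Fin n) (Fin n) ℝ)ᵀ * (k x : Matrix (Fin n) (Fin n) ℝ) = 1 :=
    (Matrix.mem_orthogonalGroup_iff' _ _).mp (Matrix.mem_specialOrthogonalGroup_iff.mp (k x).2).1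
  exact (isRelativePosition_of_frame hV hn (fun i j => hf.orthonormal x i j) hk (H x)).fiberDist_eq

theorem Omega2_deformedMetric (hn : 0 < n) [MeasurableSpace M] (dv : Measure M) {g : Metric n M}
    {f : Fin n → (x : M) → TangentSpace (𝓡 n) x} (hf : IsOrthonormalFrame g f)
    (k : M → Matrix.specialOrthogonalGroup (Fin n) ℝ) (H : M → EuclideanSpace ℝ (Fin n)) :
    Omega2 dv g.inner (deformedMetric g f k H) = √(∫ x, ‖H x‖ ^ 2 ∂dv) := by
  simp_rw [Omega2, fiberDist_deformedMetric hn hf]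

end Deformed

/-! ### Parseval identity -/

/-- Parseval's identity for a vector-valued `L²` function given as the `L²` limit of an orthogonal
series. -/
theorem tendsto_sum_norm_sq_of_tendsto_eLpNorm {α E : Type*} [MeasurableSpace α] {μ : Measure α}
    [NormedAddCommGroup E] [InnerProductSpace ℝ E] {φ : ℕ → α → ℝ}
    (hφ : ∀ j, AEStronglyMeasurable (φ j) μ)
    (horth : ∀ i j, ∫ x, φ i x * φ j x ∂μ = if i = j then 1 else 0)
    (v : ℕ → E) {h : α → E} (hh : MemLp h 2 μ)
    (hlim : Tendsto (fun N => eLpNorm (fun x => h x - ∑ j ∈ Finset.range N, φ j x • v j) 2 μ)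
      atTop (𝓝 0)) :
    Tendsto (fun N => ∑ j ∈ Finset.range N, ‖v j‖ ^ 2) atTop (𝓝 (∫ x, ‖h x‖ ^ 2 ∂μ)) := by
  have hφ2 (j) : MemLp (φ j) 2 μ := by
    rw [memLp_two_iff_integrable_sq (hφ j)]
    -- Integrability is implicit in `horth`: the integral of a non-integrable function would be `0`.
    refine Integrable.of_integral_ne_zero ?_
    simp [pow_two, horth]
  have hS (N : ℕ) : MemLp (fun x => ∑ j ∈ Finset.range N, φ j x • v j) 2 μ :=
    memLp_finsetSum _ fun j _ => (memLp_top_const (v j)).smul (hφ2 j)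
  have hnorm {u : α → E} (hu : MemLp u 2 μ) : ‖hu.toLp u‖ ^ 2 = ∫ x, ‖u x‖ ^ 2 ∂μ := by
    rw [← real_inner_self_eq_norm_sq, L2.inner_def]
    refine integral_congr_ae ?_
    filter_upwards [hu.coeFn_toLp] with x hx
    rw [hx, real_inner_self_eq_norm_sq]
  have hconv := (Lp.tendsto_Lp_iff_tendsto_eLpNorm'' _ hS h hh).mpr (by
    refine hlim.congr fun N => ?_
    -- The two sides differ by the sign of the difference.
    rw [← eLpNorm_neg]
    congr 1
    ext x
    simp)
  have h2 := (hconv.norm.pow 2)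
  rw [hnorm hh] at h2
  refine h2.congr fun N => ?_
  rw [hnorm (hS N)]
  simp_rw [← real_inner_self_eq_norm_sq, sum_inner, inner_sum, real_inner_smul_left,
    real_inner_smul_right]
  have hint (i j) : Integrable (fun x => φ i x * (φ j x * inner ℝ (v i) (v j))) μ := by
    simp_rw [← mul_assoc]
    exact ((hφ2 i).integrable_mul (hφ2 j)).mul_const _
  rw [integral_finsetSum _ fun i _ => integrable_finsetSum _ fun j _ => hint i j]
  refine Finset.sum_congr rfl fun i hi => ?_
  rw [integral_finsetSum _ fun j _ => hint i j]
  simp_rw [← mul_assoc, integral_mul_const, horth]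
  simp only [ite_mul, one_mul, zero_mul, Finset.sum_ite_eq, hi, if_true]

/-- Almost surely, `‖H‖²` in `L²(M; ℝⁿ)` is the sum of the weighted series of chi-square variables
`β_j² ‖π_n (ξ_j)‖²`. -/
theorem IsRadialField.tendsto_sum {n : ℕ} {M Ω : Type*} [MeasurableSpace M] [MeasurableSpace Ω]
    {P : Measure Ω} {dv : Measure M} {β : ℕ → ℝ} {ψ : ℕ → M → ℝ}
    {ξ : ℕ → Ω → EuclideanSpace ℝ (Fin n)} {H : Ω → M → EuclideanSpace ℝ (Fin n)}
    (hH : IsRadialField P dv β ψ ξ H) (hψ : ∀ j, AEStronglyMeasurable (ψ j) dv)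
    (horth : ∀ i j, ∫ x, ψ i x * ψ j x ∂dv = if i = j then 1 else 0) :
    ∀ᵐ w ∂P, Tendsto
      (fun N => ∑ j ∈ Finset.range N, β (j + 1) ^ 2 * ‖proj n (ξ j w)‖ ^ 2) atTop
      (𝓝 (∫ x, ‖H w x‖ ^ 2 ∂dv)) := by
  filter_upwards [hH] with w ⟨hw2, hw⟩
  refine (tendsto_sum_norm_sq_of_tendsto_eLpNorm (φ := fun j => ψ (j + 1)) (fun j => hψ _)
    (fun i j => by simp [horth]) (fun j => β (j + 1) • proj n (ξ j w)) hw2 ?_).congr fun N => ?_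
  · simpa only [radialPartialSum, smul_smul, mul_comm] using hw
  · simp only [norm_smul, mul_pow, Real.norm_eq_abs, sq_abs]

/-! ### Gaussian integrals and tails -/

theorem integral_exp_mul_sq_gaussianReal {s : ℝ} (hs : s < 1 / 2) :
    ∫ x, Real.exp (s * x ^ 2) ∂(gaussianReal 0 1) = √(1 / (1 - 2 * s)) := by
  rw [integral_gaussianReal_eq_integral_smul one_ne_zero]
  have h1 (x : ℝ) : gaussianPDFReal 0 1 x • Real.exp (s * x ^ 2)
      = (√(2 * Real.pi))⁻¹ * Real.exp (-(1 / 2 - s) * x ^ 2) := by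
    simp only [gaussianPDFReal, smul_eq_mul, NNReal.coe_one, mul_one, sub_zero]
    rw [mul_assoc, ← Real.exp_add]
    congr 2
    ring
  simp_rw [h1, integral_const_mul, integral_gaussian]
  rw [← Real.sqrt_inv, ← Real.sqrt_mul (by positivity)]
  congr 1
  have : (1 - 2 * s) ≠ 0 := by linarith
  have : (1 / 2 - s) ≠ 0 := by linarith
  field_simp

theorem integral_exp_mul_norm_sq_stdGaussian (n : ℕ) {s : ℝ} (hs : s < 1 / 2) :
    ∫ x, Real.exp (s * ‖x‖ ^ 2) ∂(stdGaussian (EuclideanSpace ℝ (Fin n)))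
      = √(1 / (1 - 2 * s)) ^ n := by
  rw [← map_pi_eq_stdGaussian, integral_map (by fun_prop)
    (Continuous.aestronglyMeasurable (by fun_prop))]
  simp_rw [EuclideanSpace.norm_sq_eq, Finset.mul_sum, Real.exp_sum, Real.norm_eq_abs, sq_abs]
  rw [integral_fintype_prod_eq_pow (f := fun x => Real.exp (s * x ^ 2)),
    integral_exp_mul_sq_gaussianReal hs, Fintype.card_fin]

theorem sqrt_one_div_le_exp {s : ℝ} (hs : s < 1 / 2) :
    √(1 / (1 - 2 * s)) ≤ Real.exp (s / (1 - 2 * s)) := by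
  have h0 : 0 < 1 - 2 * s := by linarith
  refine Real.sqrt_le_iff.mpr ⟨(Real.exp_pos _).le, ?_⟩
  have h1 := Real.add_one_le_exp (2 * s / (1 - 2 * s))
  have h2 : 2 * s / (1 - 2 * s) + 1 = 1 / (1 - 2 * s) := by field_simp; ring
  rw [← Real.exp_nat_mul, ← h2]
  refine h1.trans_eq ?_
  congr 1
  push_cast
  ring

/-- Lower bound for the Gaussian tail, from the mass of the interval `[t, t + 1 / t]`, on which the
exponent `x² / 2` is at most `t² / 2 + 3 / 2`. -/
theorem le_gaussianReal_Ici {t : ℝ} (ht : 1 ≤ t) :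
    (√(2 * Real.pi))⁻¹ * Real.exp (-(3 / 2)) / t * Real.exp (-t ^ 2 / 2)
      ≤ (gaussianReal 0 1).real (Set.Ici t) := by
  have ht0 : 0 < t := by linarith
  set m := (√(2 * Real.pi))⁻¹ * Real.exp (-(3 / 2)) * Real.exp (-t ^ 2 / 2) with hm
  have h1 : ∫ x in Set.Icc t (t + 1 / t), m
      ≤ ∫ x in Set.Icc t (t + 1 / t), gaussianPDFReal 0 1 x := by
    refine setIntegral_mono_on (by simp) (integrable_gaussianPDFReal 0 1).integrableOn
      measurableSet_Icc fun x hx => ?_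
    rw [hm, mul_assoc, ← Real.exp_add, gaussianPDFReal]
    simp only [NNReal.coe_one, mul_one, sub_zero]
    gcongr
    have h3 : x ^ 2 ≤ (t + 1 / t) ^ 2 := by
      have := hx.1
      exact pow_le_pow_left₀ (by linarith) hx.2 2
    have h4 : (t + 1 / t) ^ 2 = t ^ 2 + 2 + (1 / t) ^ 2 := by field_simp; ring
    have h5 : (1 / t) ^ 2 ≤ 1 := by
      refine pow_le_one₀ (by positivity) ?_
      rw [div_le_one ht0]; exact ht
    linarith
  have h2 : (gaussianReal 0 1).real (Set.Icc t (t + 1 / t))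
      = ∫ x in Set.Icc t (t + 1 / t), gaussianPDFReal 0 1 x := by
    rw [measureReal_def, gaussianReal_apply_eq_integral _ one_ne_zero, ENNReal.toReal_ofReal]
    exact integral_nonneg fun x => gaussianPDFReal_nonneg _ _ _
  refine le_trans ?_ ((h1.trans_eq h2.symm).trans (measureReal_mono Set.Icc_subset_Ici_self))
  rw [setIntegral_const, Real.volume_real_Icc_of_le (by simp [ht0.le]), hm, smul_eq_mul]
  apply le_of_eq
  ring

theorem stdGaussian_real_le_inner {E : Type*} [NormedAddCommGroup E] [InnerProductSpace ℝ E]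
    [FiniteDimensional ℝ E] [MeasurableSpace E] [BorelSpace E] {v : E} (hv : ‖v‖ = 1) (t : ℝ) :
    (stdGaussian E).real {x | t ≤ inner ℝ v x} = (gaussianReal 0 1).real (Set.Ici t) := by
  have h1 : (stdGaussian E).map (innerSL ℝ v) = gaussianReal 0 1 := by
    rw [IsGaussian.map_eq_gaussianReal, integral_strongDual_stdGaussian, variance_dual_stdGaussian,
      innerSL_apply_norm, hv]
    simp
  rw [← h1, map_measureReal_apply (by fun_prop) measurableSet_Ici]
  rfl

/-! ### Chernoff bound -/

/-- Chernoff's bound for an almost sure limit of random variables whose exponential moments are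
uniformly bounded; Fatou's lemma carries the bound to the limit. -/
theorem measureReal_le_exp_mul_of_tendsto {Ω : Type*} [MeasurableSpace Ω] {P : Measure Ω}
    [IsFiniteMeasure P] {X : ℕ → Ω → ℝ} {W : Ω → ℝ} {θ K : ℝ} (hθ : 0 ≤ θ)
    (hX : ∀ N, AEMeasurable (X N) P) (hint : ∀ N, Integrable (fun w => Real.exp (θ * X N w)) P)
    (hK : ∀ N, mgf (X N) P θ ≤ K)
    (hlim : ∀ᵐ w ∂P, Tendsto (fun N => X N w) atTop (𝓝 (W w))) (r : ℝ) :
    P.real {w | r ≤ W w} ≤ Real.exp (-θ * r) * K := by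
  have hK0 : 0 ≤ K := mgf_nonneg.trans (hK 0)
  have hW : AEMeasurable W P := aemeasurable_of_tendsto_metrizable_ae atTop hX hlim
  have hWe : AEMeasurable (fun w => Real.exp (θ * W w)) P := (hW.const_mul θ).exp
  have hl : ∫⁻ w, ENNReal.ofReal (Real.exp (θ * W w)) ∂P ≤ ENNReal.ofReal K := by
    calc ∫⁻ w, ENNReal.ofReal (Real.exp (θ * W w)) ∂P
        = ∫⁻ w, liminf (fun N => ENNReal.ofReal (Real.exp (θ * X N w))) atTop ∂P := by
          refine lintegral_congr_ae ?_
          filter_upwards [hlim] with w hw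
          refine (Tendsto.liminf_eq ?_).symm
          exact ENNReal.tendsto_ofReal ((hw.const_mul θ).rexp)
      _ ≤ liminf (fun N => ∫⁻ w, ENNReal.ofReal (Real.exp (θ * X N w)) ∂P) atTop :=
          lintegral_liminf_le' fun N => ((hX N).const_mul θ).exp.ennreal_ofReal
      _ ≤ ENNReal.ofReal K := by
          refine liminf_le_of_frequently_le' (Frequently.of_forall fun N => ?_)
          rw [← ofReal_integral_eq_lintegral_ofReal (hint N)
            (ae_of_all _ fun w => (Real.exp_pos _).le)]
          exact ENNReal.ofReal_le_ofReal (hK N)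
  have hWi : Integrable (fun w => Real.exp (θ * W w)) P := by
    refine ⟨hWe.aestronglyMeasurable, ?_⟩
    rw [hasFiniteIntegral_iff_ofReal (ae_of_all _ fun w => (Real.exp_pos _).le)]
    exact hl.trans_lt ENNReal.ofReal_lt_top
  refine (measure_ge_le_exp_mul_mgf r hθ hWi).trans ?_
  gcongr
  rw [← ofReal_integral_eq_lintegral_ofReal hWi (ae_of_all _ fun w => (Real.exp_pos _).le)] at hl
  exact (ENNReal.ofReal_le_ofReal_iff hK0).mp hl

/-! ### Weighted sums of chi-square variables -/

section Gaussian

variable {n : ℕ} {Ω : Type*} [MeasurableSpace Ω] {P : Measure Ω}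
  {ξ : ℕ → Ω → EuclideanSpace ℝ (Fin n)}

/-- The Laplace transform of a chi-square variable with `n` degrees of freedom is positive and at
most `exp (n s / δ)` as long as `1 - 2 s ≥ δ`. -/
theorem IsIIDStdGaussian.mgf_norm_sq_le (hξ : IsIIDStdGaussian P ξ) (j : ℕ) {s δ : ℝ}
    (hs : 0 ≤ s) (hδ : 0 < δ) (hsδ : 2 * s ≤ 1 - δ) :
    mgf (fun w => ‖ξ j w‖ ^ 2) P s ∈ Set.Ioc 0 (Real.exp (n * s / δ)) := by
  have h1 : mgf (fun w => ‖ξ j w‖ ^ 2) P s = √(1 / (1 - 2 * s)) ^ n := by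
    rw [← integral_exp_mul_norm_sq_stdGaussian n (by linarith), ← (hξ.law j).map_eq,
      integral_map (hξ.law j).aemeasurable (Continuous.aestronglyMeasurable (by fun_prop))]
    rfl
  have h0 : 0 < 1 - 2 * s := by linarith
  rw [h1]
  refine ⟨by positivity, ?_⟩
  calc √(1 / (1 - 2 * s)) ^ n ≤ Real.exp (s / (1 - 2 * s)) ^ n := by
        gcongr; exact sqrt_one_div_le_exp (by linarith)
    _ = Real.exp (n * (s / (1 - 2 * s))) := (Real.exp_nat_mul _ _).symm
    _ ≤ Real.exp (n * s / δ) := by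
        rw [mul_div_assoc]
        gcongr
        linarith

/-- Chernoff's bound at `θ` for `∑ j, b j ^ 2 * ‖π_n (ξ j)‖ ^ 2`, when all `2 θ b j ^ 2` stay `δ`
below the singularity `1` of the Laplace transform. The estimate `‖π_n x‖ ≤ ‖x‖` is used, so that
the chi-square variables have `n` instead of `n - 1` degrees of freedom. -/
theorem IsIIDStdGaussian.measureReal_le (hξ : IsIIDStdGaussian P ξ) {b : ℕ → ℝ}
    (hb : Summable fun j => b j ^ 2) {θ δ : ℝ} (hθ : 0 ≤ θ) (hδ : 0 < δ)
    (hbδ : ∀ j, 2 * (θ * b j ^ 2) ≤ 1 - δ) {W : Ω → ℝ}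
    (hlim : ∀ᵐ w ∂P, Tendsto (fun N => ∑ j ∈ Finset.range N, b j ^ 2 * ‖proj n (ξ j w)‖ ^ 2) atTop
      (𝓝 (W w))) (r : ℝ) :
    P.real {w | r ≤ W w} ≤ Real.exp (-θ * r + θ / δ * (n * ∑' j, b j ^ 2)) := by
  have : IsProbabilityMeasure P := hξ.indep.isProbabilityMeasure
  have hm (j) : AEMeasurable (ξ j) P := (hξ.law j).aemeasurable
  set Y : ℕ → Ω → ℝ := fun j w => b j ^ 2 * ‖ξ j w‖ ^ 2 with hY
  have hYm (j) : AEMeasurable (Y j) P := by fun_prop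
  have hYi : iIndepFun Y P := by
    exact hξ.indep.comp (fun j x => b j ^ 2 * ‖x‖ ^ 2) fun j => by fun_prop
  have hmgf (j) : mgf (Y j) P θ ∈ Set.Ioc 0 (Real.exp (θ / δ * (n * b j ^ 2))) := by
    have h1 := hξ.mgf_norm_sq_le j (mul_nonneg hθ (sq_nonneg (b j))) hδ (hbδ j)
    have h2 : mgf (Y j) P θ = mgf (fun w => ‖ξ j w‖ ^ 2) P (θ * b j ^ 2) := by
      simp only [mgf, hY, mul_assoc]
    rw [h2]
    convert h1 using 3
    ring
  have hsum (N : ℕ) : mgf (∑ j ∈ Finset.range N, Y j) P θ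
      ∈ Set.Ioc 0 (Real.exp (θ / δ * (n * ∑' j, b j ^ 2))) := by
    rw [hYi.mgf_sum₀ hYm]
    refine ⟨Finset.prod_pos fun j _ => (hmgf j).1, ?_⟩
    refine (Finset.prod_le_prod (fun j _ => (hmgf j).1.le) fun j _ => (hmgf j).2).trans ?_
    rw [← Real.exp_sum, ← Finset.mul_sum, ← Finset.mul_sum]
    gcongr
    exact hb.sum_le_tsum _ fun j _ => sq_nonneg _
  have hXm (N : ℕ) : AEMeasurable
      (fun w => ∑ j ∈ Finset.range N, b j ^ 2 * ‖proj n (ξ j w)‖ ^ 2) P := by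
    fun_prop
  have hle (N : ℕ) (w : Ω) :
      Real.exp (θ * ∑ j ∈ Finset.range N, b j ^ 2 * ‖proj n (ξ j w)‖ ^ 2)
        ≤ Real.exp (θ * (∑ j ∈ Finset.range N, Y j) w) := by
    rw [Finset.sum_apply]
    gcongr
    exact mul_le_mul_of_nonneg_left (pow_le_pow_left₀ (norm_nonneg _)
      ((traceZero n).norm_starProjection_apply_le _) 2) (sq_nonneg _)
  have hint (N : ℕ) : Integrable (fun w => Real.exp (θ * (∑ j ∈ Finset.range N, Y j) w)) P :=
    -- A positive Bochner integral is not a junk value.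
    .of_integral_ne_zero (hsum N).1.ne'
  have hint' (N : ℕ) : Integrable
      (fun w => Real.exp (θ * ∑ j ∈ Finset.range N, b j ^ 2 * ‖proj n (ξ j w)‖ ^ 2)) P := by
    refine (hint N).mono' ((hXm N).const_mul θ).exp.aestronglyMeasurable (ae_of_all _ fun w => ?_)
    rw [Real.norm_of_nonneg (Real.exp_pos _).le]
    exact hle N w
  rw [Real.exp_add]
  exact measureReal_le_exp_mul_of_tendsto hθ hXm hint'
    (fun N => (integral_mono (hint' N) (hint N) (hle N)).trans (hsum N).2) hlim r

theorem exists_mem_traceZero_norm_eq_one (hn : 2 ≤ n) : ∃ v ∈ traceZero n, ‖v‖ = 1 := by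
  set i : Fin n := ⟨0, by omega⟩
  set j : Fin n := ⟨1, by omega⟩
  set u : EuclideanSpace ℝ (Fin n) := EuclideanSpace.single i 1 - EuclideanSpace.single j 1
  have hij : i ≠ j := by simp [i, j]
  have hu : u ∈ traceZero n := by
    change ∑ l, u l = 0
    simp [u]
  have hu0 : u ≠ 0 := by
    intro h
    have := congrArg (fun x : EuclideanSpace ℝ (Fin n) => x i) h
    simp [u, hij] at this
  exact ⟨(‖u‖⁻¹ : ℝ) • u, (traceZero n).smul_mem _ hu, norm_smul_inv_norm (𝕜 := ℝ) hu0⟩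

/-- The norm of `π_n (ξ j)` is at least the standard normal variable `⟪v, ξ j⟫`, for any unit vector
`v` of the hyperplane of trace zero. -/
theorem IsIIDStdGaussian.le_measureReal (hξ : IsIIDStdGaussian P ξ) (hn : 2 ≤ n) (j : ℕ) {t : ℝ}
    (ht : 1 ≤ t) :
    (√(2 * Real.pi))⁻¹ * Real.exp (-(3 / 2)) / t * Real.exp (-t ^ 2 / 2)
      ≤ P.real {w | t ≤ ‖proj n (ξ j w)‖} := by
  have : IsProbabilityMeasure P := hξ.indep.isProbabilityMeasure
  obtain ⟨v, hv, hv1⟩ := exists_mem_traceZero_norm_eq_one hn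
  refine (le_gaussianReal_Ici ht).trans ?_
  rw [← stdGaussian_real_le_inner hv1,
    ← (hξ.law j).measureReal_eq (measurableSet_le measurable_const (by fun_prop))]
  refine measureReal_mono fun w (hw : t ≤ _) => hw.trans ?_
  have h1 : proj n v = v := Submodule.starProjection_eq_self_iff.mpr hv
  calc inner ℝ v (ξ j w) = inner ℝ v (proj n (ξ j w)) := by
        conv_lhs => rw [← h1]
        exact Submodule.inner_starProjection_left_eq_right _ _ _
    _ ≤ ‖v‖ * ‖proj n (ξ j w)‖ := real_inner_le_norm _ _
    _ = _ := by rw [hv1, one_mul]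

end Gaussian

/-! ### The coefficients -/

section Coefficients

variable {n : ℕ} {β : ℕ → ℝ}

theorem sq_constA (hn : 2 ≤ n) :
    constA n β ^ 2 = ((n : ℝ) - 1) * ∑' j : ℕ, β (j + 1) ^ 2 := by
  have hn' : (2 : ℝ) ≤ n := by exact_mod_cast hn
  exact Real.sq_sqrt (mul_nonneg (by linarith) (tsum_nonneg fun j => sq_nonneg _))

theorem le_constA (hn : 2 ≤ n) (hβ : Summable fun j : ℕ => β (j + 1) ^ 2) :
    β 1 ≤ constA n β := by
  have hn' : (2 : ℝ) ≤ n := by exact_mod_cast hn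
  have h1 : β 1 ^ 2 ≤ ∑' j : ℕ, β (j + 1) ^ 2 :=
    hβ.le_tsum 0 fun j _ => sq_nonneg _
  refine Real.le_sqrt_of_sq_le (h1.trans ?_)
  exact le_mul_of_one_le_left (tsum_nonneg fun j => sq_nonneg _) (by linarith)

/-- Since `n ≤ 2 (n - 1)`, replacing `n - 1` by `n` degrees of freedom costs a factor `2` only. -/
theorem mul_tsum_le_two_mul_sq_constA (hn : 2 ≤ n) :
    n * ∑' j : ℕ, β (j + 1) ^ 2 ≤ 2 * constA n β ^ 2 := by
  have hn' : (2 : ℝ) ≤ n := by exact_mod_cast hn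
  rw [sq_constA hn, ← mul_assoc]
  exact mul_le_mul_of_nonneg_right (by linarith) (tsum_nonneg fun j => sq_nonneg _)

/-- The coefficients `β_j` are nonnegative, as values of a decreasing function with limit `0`, and
`β_1` is the largest. -/
theorem sq_le_sq_of_antitoneOn {F : ℝ → ℝ} {lam : ℕ → ℝ} (hlam : Monotone lam)
    (hF : AntitoneOn F (Set.Ici (lam 1))) (hF0 : Tendsto F atTop (𝓝 0))
    (hβ : ∀ j, 1 ≤ j → β j = F (lam j)) (j : ℕ) : β (j + 1) ^ 2 ≤ β 1 ^ 2 := by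
  have hmem : lam (j + 1) ∈ Set.Ici (lam 1) := hlam (by omega)
  have h0 : 0 ≤ F (lam (j + 1)) := by
    refine le_of_tendsto hF0 ?_
    filter_upwards [eventually_ge_atTop (lam (j + 1))] with t ht
    exact hF hmem (le_trans hmem ht) ht
  rw [hβ _ (by omega), hβ 1 le_rfl]
  exact pow_le_pow_left₀ h0 (hF Set.self_mem_Ici hmem hmem) 2

end Coefficients

/-! ### Tail estimates for the distance -/

section Tail

variable {n : ℕ} {Ω : Type*} [MeasurableSpace Ω] {P : Measure Ω}
  {ξ : ℕ → Ω → EuclideanSpace ℝ (Fin n)} {β : ℕ → ℝ} {W : Ω → ℝ} {R : ℝ}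

theorem IsIIDStdGaussian.measureReal_le_exp (hξ : IsIIDStdGaussian P ξ) (hn : 2 ≤ n)
    (hβ1 : 0 < β 1) (hβ : Summable fun j : ℕ => β (j + 1) ^ 2)
    (hβle : ∀ j, β (j + 1) ^ 2 ≤ β 1 ^ 2)
    (hlim : ∀ᵐ w ∂P, Tendsto
      (fun N => ∑ j ∈ Finset.range N, β (j + 1) ^ 2 * ‖proj n (ξ j w)‖ ^ 2) atTop (𝓝 (W w)))
    (hR : constA n β ≤ R) :
    P.real {w | R ^ 2 ≤ W w} ≤
      Real.exp (-R ^ 2 / (2 * β 1 ^ 2) + 3 * constA n β / (2 * β 1 ^ 2) * R) := by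
  have hA : 0 < constA n β := hβ1.trans_le (le_constA hn hβ)
  have hR0 : 0 < R := hA.trans_le hR
  set A := constA n β
  set m := β 1 ^ 2
  have hm : 0 < m := by positivity
  have hδ1 : A / R ≤ 1 := (div_le_one hR0).mpr hR
  -- The parameter at distance `A / R` from the singularity: then `-θ R²` exceeds `-R² / (2 m)` by
  -- `A R / (2 m)`, and the moment contributes at most `2 A² / (2 m) / (A / R) = 2 A R / (2 m)`.
  set θ := (1 - A / R) / (2 * m) with hθ
  have hθ0 : 0 ≤ θ := div_nonneg (by linarith) (by positivity)
  have hθm : 2 * (θ * m) = 1 - A / R := by rw [hθ]; field_simp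
  have hθ1 : θ ≤ 1 / (2 * m) := by
    rw [hθ]
    gcongr
    have : 0 < A / R := by positivity
    linarith
  refine (hξ.measureReal_le hβ hθ0 (div_pos hA hR0) (fun j => ?_) hlim (R ^ 2)).trans ?_
  · rw [← hθm]
    gcongr
    exact hβle j
  · rw [Real.exp_le_exp]
    have h1 : θ / (A / R) * (n * ∑' j : ℕ, β (j + 1) ^ 2)
        ≤ 1 / (2 * m) / (A / R) * (2 * A ^ 2) :=
      mul_le_mul (by gcongr) (mul_tsum_le_two_mul_sq_constA hn)
        (mul_nonneg n.cast_nonneg (tsum_nonneg fun j => sq_nonneg _)) (by positivity)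
    refine (add_le_add_right h1 _).trans_eq ?_
    rw [hθ]
    field_simp
    ring

/-- The first term `β_1² ‖π_n (ξ_1)‖²` of the series already has the required tail. -/
theorem IsIIDStdGaussian.exp_le_measureReal (hξ : IsIIDStdGaussian P ξ) (hn : 2 ≤ n)
    (hβ1 : 0 < β 1)
    (hlim : ∀ᵐ w ∂P, Tendsto
      (fun N => ∑ j ∈ Finset.range N, β (j + 1) ^ 2 * ‖proj n (ξ j w)‖ ^ 2) atTop (𝓝 (W w)))
    (hR : β 1 ≤ R) :
    (√(2 * Real.pi))⁻¹ * Real.exp (-(3 / 2)) * β 1 / R * Real.exp (-R ^ 2 / (2 * β 1 ^ 2))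
      ≤ P.real {w | R ^ 2 ≤ W w} := by
  have : IsProbabilityMeasure P := hξ.indep.isProbabilityMeasure
  have hR0 : 0 < R := hβ1.trans_le hR
  have h1 := hξ.le_measureReal hn 0 (t := R / β 1) ((one_le_div hβ1).mpr hR)
  have h2 : (√(2 * Real.pi))⁻¹ * Real.exp (-(3 / 2)) * β 1 / R
        * Real.exp (-R ^ 2 / (2 * β 1 ^ 2))
      = (√(2 * Real.pi))⁻¹ * Real.exp (-(3 / 2)) / (R / β 1)
        * Real.exp (-(R / β 1) ^ 2 / 2) := by
    rw [div_div_eq_mul_div]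
    congr 2
    field_simp
  rw [h2]
  refine h1.trans (ENNReal.toReal_mono (measure_ne_top _ _) (measure_mono_ae ?_))
  filter_upwards [hlim] with w hw
  intro (hRw : R / β 1 ≤ ‖proj n (ξ 0 w)‖)
  change R ^ 2 ≤ W w
  have h3 : β 1 ^ 2 * ‖proj n (ξ 0 w)‖ ^ 2 ≤ W w := by
    refine ge_of_tendsto hw ?_
    filter_upwards [eventually_ge_atTop 1] with N hN
    exact Finset.single_le_sum (f := fun j => β (j + 1) ^ 2 * ‖proj n (ξ j w)‖ ^ 2)
      (fun j _ => by positivity) (Finset.mem_range.mpr hN)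
  refine le_trans ?_ h3
  rw [← mul_pow]
  gcongr
  rwa [div_le_iff₀' hβ1] at hRw

end Tail

end RandomMetric

theorem mainTheorem2 :
    ∃ c : ℝ, 0 < c ∧ ∃ C : ℝ → ℝ → ℝ → ℝ, (∀ A B m, 0 < C A B m) ∧
      ∀ (n : ℕ), 2 ≤ n →
      -- the compact manifold, its reference metric, volume and orthonormal frame
      ∀ (M : Type*) [TopologicalSpace M] [T2Space M] [CompactSpace M]
        [ChartedSpace (EuclideanSpace ℝ (Fin n)) M] [IsManifold (𝓡 n) ∞ M]
        [MeasurableSpace M] [BorelSpace M]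
        (g₀ : RandomMetric.Metric n M) (dv : Measure M),
      RandomMetric.IsRiemannianVolume g₀ dv →
      ∀ (f : Fin n → (x : M) → TangentSpace (𝓡 n) x),
      RandomMetric.IsOrthonormalFrame g₀ f →
      -- the Laplace spectrum and the decay coefficients
      ∀ (lam : ℕ → ℝ) (ψ : ℕ → M → ℝ),
      RandomMetric.IsSpectralBasis g₀ dv lam ψ →
      ∀ (F : ℝ → ℝ) (β : ℕ → ℝ),
      AntitoneOn F (Set.Ici (lam 1)) → Tendsto F atTop (𝓝 0) →
      (∀ j, 1 ≤ j → β j = F (lam j)) →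
      0 < β 1 → (Summable fun j : ℕ => β (j + 1) ^ 2) →
      -- the Gaussian field `H` and the rotations `k`, which define the random metric
      ∀ (Ω : Type*) [MeasurableSpace Ω] (P : Measure Ω) [IsProbabilityMeasure P]
        (ξ : ℕ → Ω → EuclideanSpace ℝ (Fin n)),
      RandomMetric.IsIIDStdGaussian P ξ →
      ∀ (H : Ω → M → EuclideanSpace ℝ (Fin n)),
      RandomMetric.IsRadialField P dv β ψ ξ H →
      ∀ (k : Ω → M → Matrix.specialOrthogonalGroup (Fin n) ℝ) (R : ℝ),
      RandomMetric.constA n β ≤ R →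
      c * β 1 / R * Real.exp (-R ^ 2 / (2 * β 1 ^ 2)) ≤
          P.real {w | R ≤ RandomMetric.Omega2 dv g₀.inner
            (RandomMetric.deformedMetric g₀ f (k w) (H w))} ∧
        P.real {w | R ≤ RandomMetric.Omega2 dv g₀.inner
            (RandomMetric.deformedMetric g₀ f (k w) (H w))} ≤
          Real.exp (-R ^ 2 / (2 * β 1 ^ 2) +
            C (RandomMetric.constA n β) (RandomMetric.constB n β) (β 1 ^ 2) * R) := by
  refine ⟨(√(2 * Real.pi))⁻¹ * Real.exp (-(3 / 2)), by positivity,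
    -- The summand `1` and the absolute value keep the constant positive at all arguments.
    fun A _ m => 1 + |3 * A / (2 * m)|, fun A B m => by positivity, ?_⟩
  intro n hn M _ _ _ _ _ _ _ g₀ dv _ f hf lam ψ hψ F β hF hF0 hβF hβ1 hβ Ω _ P _ ξ hξ H hH k R hR
  have hβA := RandomMetric.le_constA hn hβ
  have hR0 : 0 < R := hβ1.trans_le (hβA.trans hR)
  have hlim := hH.tendsto_sum (fun j => (hψ.smooth j).continuous.measurable.aestronglyMeasurable)
    hψ.orthonormal
  have hset : {w | R ≤ RandomMetric.Omega2 dv g₀.inner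
      (RandomMetric.deformedMetric g₀ f (k w) (H w))} = {w | R ^ 2 ≤ ∫ x, ‖H w x‖ ^ 2 ∂dv} := by
    ext w
    simp only [Set.mem_ofPred_eq]
    rw [RandomMetric.Omega2_deformedMetric (by omega) dv hf, Real.le_sqrt' hR0]
  rw [hset]
  refine ⟨hξ.exp_le_measureReal hn hβ1 hlim (hβA.trans hR),
    (hξ.measureReal_le_exp hn hβ1 hβ
      (RandomMetric.sq_le_sq_of_antitoneOn hψ.monotone hF hF0 hβF) hlim hR).trans ?_⟩
  gcongr
  exact (le_abs_self _).trans (le_add_of_nonneg_left zero_le_one)
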